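/- Let $H$ be a separable infinite-dimensional complex Hilbert space. For a positive compact operator $a$ on $H$ let $\lambda_1(a)\ge\lambda_2(a)\ge\cdots\ge 0$ be its eigenvalue sequence, that is, the eigenvalues of $a$ in decreasing order, counted with multiplicity, padded with zeros if $a$ has finite rank (so that, if $a$ does not have finite rank, all $\lambda_n(a)$ are non-zero and $\lambda_n(a)\to 0$). Let $\alpha:\{0,1,2,\dots\}\to[0,\infty)$ be a monotone increasing function with $\alpha(0)=0$ and $\alpha(1)>0$, and define the non-linear trace of Choquet type $$\varphi_\alpha(a)=\sum_{i=1}^\infty\bigl(\lambda_i(a)-\lambda_{i+1}(a)\bigr)\,\alpha(i)\in[0,\infty].$$ For a compact operator $a$ on $H$ put $|||a|||_\alpha=\varphi_\alpha(|a|)\in[0,\infty]$, where $|a|=(a^*a)^{1/2}$, and let $\mathcal C^\alpha_1(H)$ be the set of all compact operators $a$ on $H$ with $|||a|||_\alpha<\infty$. Suppose that $\alpha$ is concave in the sense that $\frac{\alpha(i+1)+\alpha(i-1)}{2}\le\alpha(i)$ for all $i\ge 1$. Then $\mathcal C^\alpha_1(H)$ is a complex linear subspace of $B(H)$, $|||\cdot|||_\alpha$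 is a norm on it, and $\mathcal C^\alpha_1(H)$ is complete with respect to this norm, i.e. it is a Banach space. Moreover $\mathcal C^\alpha_1(H)$ is a $*$-ideal of $B(H)$: it is a two-sided ideal, and $a^*\in\mathcal C^\alpha_1(H)$ whenever $a\in\mathcal C^\alpha_1(H)$. -/

import Mathlib

open scoped NNReal ENNReal InnerProductSpace

noncomputable section

namespace ChoquetTrace

variable {H : Type*} [NormedAddCommGroup H] [InnerProductSpace ℂ H]

/-- The span of all eigenvectors of `a` with a real eigenvalue `> t`. Eigenspaces being independent,
its dimension is the number of eigenvalues of `a` larger than `t`, counted with multiplicity. -/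
def spectralSpan (a : H →L[ℂ] H) (t : ℝ) : Submodule ℂ H :=
  ⨆ μ : {μ : ℝ // t < μ}, Module.End.eigenspace (a : H →ₗ[ℂ] H) ((μ : ℝ) : ℂ)

/-- The eigenvalue sequence of a positive compact operator `a`: the eigenvalues in decreasing
order, counted with multiplicity, and padded with zeros if `a` has finite rank. The indices start
at `0`, so `eigenvalueSeq a n` is the `(n + 1)`-st eigenvalue `λ_{n+1}(a)`: the least `t ≥ 0` such
that at most `n` eigenvalues, counted with multiplicity, are larger than `t`. -/
def eigenvalueSeq (a : H →L[ℂ] H) (n : ℕ) : ℝ :=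
  sInf {t : ℝ | 0 ≤ t ∧ Module.rank ℂ (spectralSpan a t) ≤ n}

/-- The non-linear trace of Choquet type
`φ_α(a) = ∑_{i ≥ 1} (λ_i(a) - λ_{i+1}(a)) α(i) ∈ [0, ∞]` of a positive compact operator `a`. -/
def choquetTrace (α : ℕ → ℝ≥0) (a : H →L[ℂ] H) : ℝ≥0∞ :=
  ∑' i : ℕ, ENNReal.ofReal (eigenvalueSeq a i - eigenvalueSeq a (i + 1)) * (α (i + 1) : ℝ≥0∞)

/-- `|||a|||_α = φ_α(|a|) ∈ [0, ∞]`, where `|a| = (a* a)^{1/2}`. -/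
def choquetENorm [CompleteSpace H] (α : ℕ → ℝ≥0) (a : H →L[ℂ] H) : ℝ≥0∞ :=
  choquetTrace α (CFC.abs a)

/-- The weighted trace class: the compact operators `a` with `φ_α(|a|) < ∞`. -/
def weightedTraceClass [CompleteSpace H] (α : ℕ → ℝ≥0) : Set (H →L[ℂ] H) :=
  {a | IsCompactOperator a ∧ choquetENorm α a < ∞}

/-- The complex vector space `E` is a Banach space with respect to the norm `N`: the function `N`
is a norm, and `E` is complete for the metric that it defines. -/
def IsBanachSpaceFor {E : Type*} [AddCommGroup E] [Module ℂ E] (N : E → ℝ) : Prop :=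
  letI : Norm E := ⟨N⟩
  ∃ core : NormedSpace.Core ℂ E,
    letI : NormedAddCommGroup E := NormedAddCommGroup.ofCore core
    CompleteSpace E

/-- The eigenvalue sequence is the usual one: if `a = ∑ₙ sₙ pₙ` with a decreasing sequence
`sₙ → 0` and mutually orthogonal one-dimensional projections `pₙ = ⟨eₙ, ·⟩ eₙ`, then
`s` is the eigenvalue sequence of `a`. -/
theorem eigenvalueSeq_eq (a : H →L[ℂ] H) (s : ℕ → ℝ) (hs : Antitone s)
    (hs0 : Filter.Tendsto s Filter.atTop (nhds 0)) (e : ℕ → H) (he : Orthonormal ℂ e)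
    (hae : ∀ x, HasSum (fun n => ((s n : ℂ) * ⟪e n, x⟫_ℂ) • e n) (a x)) :
    eigenvalueSeq a = s := by
  have hpos : ∀ n, 0 ≤ s n := fun n => hs.le_of_tendsto hs0 n
  have hcoord : ∀ x m, ⟪e m, a x⟫_ℂ = (s m : ℂ) * ⟪e m, x⟫_ℂ := by
    intro x m
    have h1 := (hae x).mapL (innerSL ℂ (e m))
    have h2 : HasSum (fun n => innerSL ℂ (e m) (((s n : ℂ) * ⟪e n, x⟫_ℂ) • e n))
        ((s m : ℂ) * ⟪e m, x⟫_ℂ) := by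
      have h3 := hasSum_single (f := fun n => innerSL ℂ (e m) (((s n : ℂ) * ⟪e n, x⟫_ℂ) • e n)) m
        (by intro n hn; simp [orthonormal_iff_ite.1 he, hn.symm])
      simpa [inner_smul_right, orthonormal_iff_ite.1 he, he.1 m] using h3
    exact h1.unique h2
  have heig : ∀ m, a (e m) = (s m : ℂ) • e m := by
    intro m
    refine (hae (e m)).unique ?_
    have h3 := hasSum_single (f := fun n => ((s n : ℂ) * ⟪e n, e m⟫_ℂ) • e n) m
        (by intro n hn; simp [orthonormal_iff_ite.1 he, hn])
    simpa [orthonormal_iff_ite.1 he, he.1 m] using h3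
  have hspan : ∀ t, 0 ≤ t →
      spectralSpan a t = Submodule.span ℂ (e '' {n | t < s n}) := by
    intro t ht
    have hfin : {n | t < s n}.Finite ∨ t = 0 := by
      rcases ht.eq_or_lt with h | h
      · exact Or.inr h.symm
      · left
        have := hs0.eventually (gt_mem_nhds h)
        obtain ⟨N, hN⟩ := Filter.eventually_atTop.1 this
        refine (Set.finite_lt_nat N).subset fun n hn => ?_
        by_contra hc
        exact absurd (hN n (not_lt.1 hc)) (not_lt.2 (le_of_lt hn))
    apply le_antisymm
    · refine iSup_le ?_
      rintro ⟨μ, hμ⟩ x hx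
      have hμ0 : 0 < μ := ht.trans_lt hμ
      have hx' : a x = (μ : ℂ) • x := Module.End.mem_eigenspace_iff.1 hx
      have hmuC : (μ : ℂ) ≠ 0 := by exact_mod_cast hμ0.ne'
      have hzero : ∀ m, s m ≠ μ → ⟪e m, x⟫_ℂ = 0 := by
        intro m hm
        have h1 := hcoord x m
        rw [hx', inner_smul_right] at h1
        have h2 : ((μ : ℂ) - s m) * ⟪e m, x⟫_ℂ = 0 := by rw [sub_mul, h1, sub_self]
        rcases mul_eq_zero.1 h2 with h | h
        · exact absurd (by exact_mod_cast (sub_eq_zero.1 h).symm) hm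
        · exact h
      have hfin2 : {n | s n = μ}.Finite := by
        obtain ⟨N, hN⟩ := Filter.eventually_atTop.1 (hs0.eventually (gt_mem_nhds hμ0))
        refine (Set.finite_lt_nat N).subset fun n hn => ?_
        by_contra hc
        exact absurd (hN n (not_lt.1 hc)) (not_lt.2 (le_of_eq (Eq.symm hn)))
      have hsum : a x = ∑ n ∈ hfin2.toFinset, ((s n : ℂ) * ⟪e n, x⟫_ℂ) • e n := by
        refine (hae x).unique (hasSum_sum_of_ne_finset_zero ?_)
        intro n hn
        rw [hzero n (by simpa using hn)]
        simp
      have hmem : a x ∈ Submodule.span ℂ (e '' {n | t < s n}) := by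
        rw [hsum]
        refine Submodule.sum_mem _ fun n hn => Submodule.smul_mem _ _ (Submodule.subset_span ?_)
        refine ⟨n, ?_, rfl⟩
        have : s n = μ := by simpa using hn
        simpa [this] using hμ
      rw [hx'] at hmem
      exact (Submodule.smul_mem_iff _ hmuC).1 hmem
    · rw [Submodule.span_le]
      rintro _ ⟨n, hn, rfl⟩
      exact (le_iSup (fun μ : {μ : ℝ // t < μ} =>
        Module.End.eigenspace (a : H →ₗ[ℂ] H) ((μ : ℝ) : ℂ)) ⟨s n, hn⟩)
        (Module.End.mem_eigenspace_iff.2 (heig n))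
  have hrank : ∀ t, 0 ≤ t → ∀ n : ℕ, Module.rank ℂ (spectralSpan a t) ≤ n ↔ s n ≤ t := by
    intro t ht n
    have hinj : Function.Injective e := he.linearIndependent.injective
    have hli : LinearIndepOn ℂ id (e '' {n | t < s n}) :=
      (he.linearIndependent.linearIndepOn {n | t < s n}).id_image
    rw [hspan t ht, rank_span_set hli]
    constructor
    · intro h
      by_contra hc
      have hsub : e '' (Set.Iic n) ⊆ e '' {n | t < s n} :=
        Set.image_mono fun m hm => (not_le.1 hc).trans_le (hs hm)
      have h1 := (Cardinal.mk_le_mk_of_subset hsub).trans h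
      have h2 := Cardinal.mk_image_eq_lift e (Set.Iic n) hinj
      have h4 := Cardinal.lift_le.{0}.2 h1
      rw [h2] at h4
      simp at h4
    · intro h
      have hsub : e '' {m | t < s m} ⊆ e '' (Set.Iio n) := by
        refine Set.image_mono fun m hm => ?_
        by_contra hc
        exact absurd ((hs (not_lt.1 hc)).trans h) (not_le.2 hm)
      refine (Cardinal.mk_le_mk_of_subset hsub).trans ?_
      have h2 := Cardinal.mk_image_le_lift (f := e) (s := Set.Iio n)
      simpa using h2
  funext n
  have hset : {t : ℝ | 0 ≤ t ∧ Module.rank ℂ (spectralSpan a t) ≤ n} = Set.Ici (s n) := by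
    ext t
    constructor
    · rintro ⟨h0, h1⟩
      exact (hrank t h0 n).1 h1
    · intro h
      exact ⟨(hpos n).trans h, (hrank t ((hpos n).trans h) n).2 h⟩
  rw [eigenvalueSeq, hset, csInf_Ici]

end ChoquetTrace

end

/-!
Concavity of `α` means that the increments `dᵢ = α (i + 1) - α i` decrease. If `a` has singular
values `sₙ`, summation by parts turns `φ_α(|a|)` into `∑ₙ dₙ sₙ`, and a rearrangement argument
identifies this sum with the supremum of `∑ᵢ dᵢ |⟨fᵢ, a eᵢ⟩|` over all families `e`, `f` that
satisfy Bessel's inequality: expanding `a` in its singular vectors leaves a matrix with row and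
column sums at most `1`, so the decreasing weights `d` are best matched with the largest singular
values. The supremum is visibly subadditive, symmetric under `a ↦ a⋆`, lower semicontinuous for
the operator norm, and at least `d₀ ‖a‖`. Since contractions preserve Bessel families, it also
satisfies the ideal inequality. Completeness follows because an operator norm limit of a Cauchy
sequence is, by lower semicontinuity, a limit for the stronger norm as well.

Singular values are obtained by repeatedly splitting off an eigenvector of `|a|` for the
eigenvalue `‖|a|‖`.
-/

noncomputable section

namespace ChoquetTrace

open Filter Topology

section CompactOperator

variable {𝕜 E F G : Type*} [NontriviallyNormedField 𝕜] [NormedAddCommGroup E] [NormedSpace 𝕜 E]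
  [NormedAddCommGroup F] [NormedSpace 𝕜 F] [NormedAddCommGroup G] [NormedSpace 𝕜 G]

theorem isCompactOperator_of_norm_apply_sq_le [CompleteSpace F] {S : E →L[𝕜] G} {T : E →L[𝕜] F}
    (hS : IsCompactOperator S) (hST : ∀ x, ‖T x‖ ^ 2 ≤ ‖S x‖ * ‖x‖) : IsCompactOperator T := by
  have hS_bdd : TotallyBounded (S '' Metric.ball 0 1) := by
    obtain ⟨K, hK, hSK⟩ := hS.image_ball_subset_compact (f := (S : E →ₗ[𝕜] G)) 1
    exact hK.totallyBounded.subset hSK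
  suffices TotallyBounded (T '' Metric.ball 0 1) from
    (isCompactOperator_iff_isCompact_closure_image_ball (T : E →ₗ[𝕜] F) one_pos).2
      (this.closure.isCompact_of_isComplete isClosed_closure.isComplete)
  refine Metric.totallyBounded_iff.2 fun ε hε => ?_
  obtain ⟨t, ht_ball, ht_fin, ht_cover⟩ := Set.exists_subset_image_finite_and.1
    (Metric.finite_approx_of_totallyBounded hS_bdd (ε ^ 2 / 2) (by positivity))
  refine ⟨T '' t, ht_fin.image T, ?_⟩
  rintro _ ⟨x, hx, rfl⟩
  obtain ⟨_, ⟨y, hy, rfl⟩, hxy⟩ := Set.mem_iUnion₂.1 (ht_cover ⟨x, hx, rfl⟩)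
  refine Set.mem_iUnion₂.2 ⟨T y, ⟨y, hy, rfl⟩, ?_⟩
  have hxy_two : ‖x - y‖ ≤ 2 := by
    linarith [norm_sub_le x y, mem_ball_zero_iff.1 hx, mem_ball_zero_iff.1 (ht_ball hy)]
  rw [mem_ball_iff_norm, ← map_sub] at hxy ⊢
  have : ‖T (x - y)‖ ^ 2 < ε ^ 2 := by
    nlinarith [hST (x - y), mul_le_mul_of_nonneg_left hxy_two (norm_nonneg (S (x - y)))]
  exact lt_of_pow_lt_pow_left₀ 2 hε.le this

end CompactOperator

section Adjoint

variable {𝕜 E F : Type*} [RCLike 𝕜] [NormedAddCommGroup E] [InnerProductSpace 𝕜 E]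
  [CompleteSpace E] [NormedAddCommGroup F] [InnerProductSpace 𝕜 F] [CompleteSpace F]

theorem norm_apply_sq_le_norm_adjoint_comp_self_apply (a : E →L[𝕜] F) (x : E) :
    ‖a x‖ ^ 2 ≤ ‖(a.adjoint ∘L a) x‖ * ‖x‖ := by
  rw [ContinuousLinearMap.apply_norm_sq_eq_inner_adjoint_left]
  exact (RCLike.re_le_norm _).trans (norm_inner_le_norm _ _)

theorem isCompactOperator_adjoint {a : E →L[𝕜] F} (ha : IsCompactOperator a) :
    IsCompactOperator a.adjoint := by
  refine isCompactOperator_of_norm_apply_sq_le (S := a ∘L a.adjoint) (ha.comp_clm a.adjoint)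
    fun x => ?_
  simpa using norm_apply_sq_le_norm_adjoint_comp_self_apply a.adjoint x

end Adjoint

section Abs

variable {H : Type*} [NormedAddCommGroup H] [InnerProductSpace ℂ H] [CompleteSpace H]

theorem inner_abs_apply_abs_apply (a : H →L[ℂ] H) (x y : H) :
    ⟪CFC.abs a x, CFC.abs a y⟫_ℂ = ⟪a x, a y⟫_ℂ := by
  have hsa : (CFC.abs a).adjoint = CFC.abs a := (CFC.abs_nonneg a).isSelfAdjoint
  have hsq : (CFC.abs a : H →L[ℂ] H).comp (CFC.abs a) = a.adjoint.comp a := CFC.abs_mul_abs a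
  rw [← ContinuousLinearMap.adjoint_inner_right, ← ContinuousLinearMap.adjoint_inner_right, hsa,
    ← ContinuousLinearMap.comp_apply, ← ContinuousLinearMap.comp_apply, hsq]

theorem norm_abs_apply (a : H →L[ℂ] H) (x : H) : ‖CFC.abs a x‖ = ‖a x‖ := by
  rw [@norm_eq_sqrt_re_inner ℂ, @norm_eq_sqrt_re_inner ℂ, inner_abs_apply_abs_apply]

theorem isCompactOperator_abs {a : H →L[ℂ] H} (ha : IsCompactOperator a) :
    IsCompactOperator (CFC.abs a : H →L[ℂ] H) := by
  refine isCompactOperator_of_norm_apply_sq_le (S := a.adjoint ∘L a) (ha.clm_comp a.adjoint)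
    fun x => ?_
  rw [norm_abs_apply]
  exact norm_apply_sq_le_norm_adjoint_comp_self_apply a x

end Abs

section Bessel

variable {𝕜 E F ι : Type*} [RCLike 𝕜] [NormedAddCommGroup E] [InnerProductSpace 𝕜 E]
  [NormedAddCommGroup F] [InnerProductSpace 𝕜 F]

variable (𝕜) in
/-- A family of vectors satisfying Bessel's inequality with constant `1`. These families take the
place of orthonormal ones because they are stable under contractions. -/
def IsBessel (e : ι → E) : Prop :=
  ∀ x, ∑' i, ‖⟪e i, x⟫_𝕜‖ₑ ^ 2 ≤ ‖x‖ₑ ^ 2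

theorem enorm_inner_le_enorm_mul_enorm (x y : E) : ‖⟪x, y⟫_𝕜‖ₑ ≤ ‖x‖ₑ * ‖y‖ₑ := by
  simpa only [← ofReal_norm, ← ENNReal.ofReal_mul (norm_nonneg x)] using
    ENNReal.ofReal_le_ofReal (norm_inner_le_norm x y)

theorem enorm_inner_comm (x y : E) : ‖⟪x, y⟫_𝕜‖ₑ = ‖⟪y, x⟫_𝕜‖ₑ := by
  rw [← ofReal_norm, norm_inner_symm, ofReal_norm]

theorem enorm_le_one_iff {x : E} : ‖x‖ₑ ≤ 1 ↔ ‖x‖ ≤ 1 := by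
  rw [← ofReal_norm, ENNReal.ofReal_le_one]

theorem two_mul_le_sq_add_sq (x y : ℝ≥0∞) : 2 * (x * y) ≤ x ^ 2 + y ^ 2 := by
  rcases eq_or_ne x ∞ with rfl | hx
  · simp
  rcases eq_or_ne y ∞ with rfl | hy
  · simp
  lift x to ℝ≥0 using hx
  lift y to ℝ≥0 using hy
  exact_mod_cast mul_assoc 2 x y ▸ two_mul_le_add_sq x y

theorem isBessel_of_orthonormal {e : ι → E} {t : Set ι} (he : Orthonormal 𝕜 fun i : t => e i)
    (he_zero : ∀ i ∉ t, e i = 0) : IsBessel 𝕜 e := by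
  intro x
  have hsupport : (Function.support fun i => ‖⟪e i, x⟫_𝕜‖ₑ ^ 2) ⊆ t := fun i hi => by
    by_contra hit
    simp [he_zero i hit] at hi
  rw [← tsum_subtype_eq_of_support_subset hsupport]
  simpa only [ENNReal.ofReal_tsum_of_nonneg (fun _ => sq_nonneg _) (he.inner_products_summable x),
    ENNReal.ofReal_pow (norm_nonneg _), ofReal_norm] using
    ENNReal.ofReal_le_ofReal (he.tsum_inner_products_le x)

theorem isBessel_single [DecidableEq ι] (i : ι) {v : E} (hv : ‖v‖ ≤ 1) :
    IsBessel 𝕜 (Pi.single i v : ι → E) := by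
  intro x
  rw [tsum_eq_single i fun j hj => by simp [hj], Pi.single_eq_same]
  gcongr
  exact (enorm_inner_le_enorm_mul_enorm v x).trans (mul_le_of_le_one_left' (enorm_le_one_iff.2 hv))

namespace IsBessel

variable {e : ι → E}

theorem norm_le_one (he : IsBessel 𝕜 e) (i : ι) : ‖e i‖ ≤ 1 := by
  have h : ‖⟪e i, e i⟫_𝕜‖ ≤ ‖e i‖ := enorm_le_iff_norm_le.1
    ((ENNReal.pow_le_pow_left_iff two_ne_zero).1 ((ENNReal.le_tsum i).trans (he (e i))))
  rw [← inner_self_re_eq_norm, inner_self_eq_norm_mul_norm] at h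
  by_contra! hlt
  nlinarith

theorem map [CompleteSpace E] [CompleteSpace F] (he : IsBessel 𝕜 e) {T : E →L[𝕜] F}
    (hT : ‖T‖ ≤ 1) : IsBessel 𝕜 fun i => T (e i) := by
  intro x
  have hx : ‖T.adjoint x‖ ≤ ‖x‖ :=
    T.adjoint.le_of_opNorm_le (by simpa using hT) x |>.trans (one_mul _).le
  simpa only [ContinuousLinearMap.adjoint_inner_right] using
    (he (T.adjoint x)).trans (pow_le_pow_left' (enorm_le_iff_norm_le.2 hx) 2)

theorem tsum_mul_le_one {f : ι → F} (he : IsBessel 𝕜 e) (hf : IsBessel 𝕜 f) {x : E} {y : F}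
    (hx : ‖x‖ ≤ 1) (hy : ‖y‖ ≤ 1) : ∑' i, ‖⟪e i, x⟫_𝕜‖ₑ * ‖⟪f i, y⟫_𝕜‖ₑ ≤ 1 := by
  have h2 : 2 * ∑' i, ‖⟪e i, x⟫_𝕜‖ₑ * ‖⟪f i, y⟫_𝕜‖ₑ ≤ 2 * 1 := calc
    2 * ∑' i, ‖⟪e i, x⟫_𝕜‖ₑ * ‖⟪f i, y⟫_𝕜‖ₑ
      ≤ ∑' i, (‖⟪e i, x⟫_𝕜‖ₑ ^ 2 + ‖⟪f i, y⟫_𝕜‖ₑ ^ 2) := by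
        rw [← ENNReal.tsum_mul_left]
        exact ENNReal.tsum_le_tsum fun i => two_mul_le_sq_add_sq _ _
    _ = ∑' i, ‖⟪e i, x⟫_𝕜‖ₑ ^ 2 + ∑' i, ‖⟪f i, y⟫_𝕜‖ₑ ^ 2 := ENNReal.tsum_add
    _ ≤ ‖x‖ₑ ^ 2 + ‖y‖ₑ ^ 2 := add_le_add (he x) (hf y)
    _ ≤ 1 ^ 2 + 1 ^ 2 := by gcongr <;> exact enorm_le_one_iff.2 ‹_›
    _ = 2 * 1 := by norm_num
  exact (ENNReal.mul_le_mul_iff_right two_ne_zero ENNReal.ofNat_ne_top).1 h2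

theorem tendsto_inner (he : IsBessel 𝕜 e) (x : E) :
    Tendsto (fun i => ⟪e i, x⟫_𝕜) cofinite (𝓝 0) := by
  have hsq : Tendsto (fun i => ‖⟪e i, x⟫_𝕜‖ₑ ^ 2) cofinite (𝓝 0) :=
    ENNReal.tendsto_cofinite_zero_of_tsum_ne_top
      ((he x).trans_lt (ENNReal.pow_lt_top enorm_lt_top)).ne
  refine tendsto_zero_iff_enorm_tendsto_zero.2 (ENNReal.tendsto_nhds_zero.2 fun ε hε => ?_)
  filter_upwards [ENNReal.tendsto_nhds_zero.1 hsq (ε ^ 2) (ENNReal.pow_pos hε 2)] with i hi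
  exact (ENNReal.pow_le_pow_left_iff two_ne_zero).1 hi

theorem tendsto_apply [CompleteSpace E] [CompleteSpace F] {e : ℕ → E} (he : IsBessel 𝕜 e)
    {a : E →L[𝕜] F} (ha : IsCompactOperator a) : Tendsto (fun n => a (e n)) atTop (𝓝 0) := by
  obtain ⟨K, hK, hK_sub⟩ := ha.image_closedBall_subset_compact (f := (a : E →ₗ[𝕜] F)) 1
  have he_mem : ∀ n, a (e n) ∈ K := fun n =>
    hK_sub ⟨e n, mem_closedBall_zero_iff.2 (he.norm_le_one n), rfl⟩
  refine tendsto_of_subseq_tendsto fun ns hns => ?_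
  obtain ⟨y, -, φ, hφ, hy⟩ := hK.tendsto_subseq fun n => he_mem (ns n)
  have hweak : Tendsto (fun n => ⟪a (e (ns (φ n))), y⟫_𝕜) atTop (𝓝 0) := by
    simp only [← ContinuousLinearMap.adjoint_inner_right]
    exact (he.tendsto_inner (a.adjoint y)).comp
      (Nat.cofinite_eq_atTop ▸ hns.comp hφ.tendsto_atTop)
  have hy_zero : y = 0 :=
    inner_self_eq_zero.1 (tendsto_nhds_unique (hy.inner tendsto_const_nhds) hweak)
  exact ⟨φ, hy_zero ▸ hy⟩

end IsBessel

end Bessel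

section SchmidtExpansion

variable {𝕜 E F : Type*} [RCLike 𝕜] [NormedAddCommGroup E] [InnerProductSpace 𝕜 E]
  [NormedAddCommGroup F] [InnerProductSpace 𝕜 F]

/-- The Schmidt expansion `a = ∑ₙ sₙ ⟨vₙ, ·⟩ uₙ` of an operator, with decreasing singular values
`sₙ → 0`. The sum converges in the operator norm. The vectors `uₙ` and `vₙ` are `0` when `sₙ = 0`,
so that finite rank operators need no separate treatment. -/
structure IsSchmidtExpansion (a : E →L[𝕜] F) (s : ℕ → ℝ) (u : ℕ → F) (v : ℕ → E) : Prop where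
  antitone : Antitone s
  tendsto_zero : Tendsto s atTop (𝓝 0)
  left_orthonormal : Orthonormal 𝕜 fun n : Function.support s => u n
  left_eq_zero : ∀ n, s n = 0 → u n = 0
  right_orthonormal : Orthonormal 𝕜 fun n : Function.support s => v n
  right_eq_zero : ∀ n, s n = 0 → v n = 0
  tendsto_sum : Tendsto
    (fun n => ∑ i ∈ Finset.range n, (s i : 𝕜) • InnerProductSpace.rankOne 𝕜 (u i) (v i))
    atTop (𝓝 a)

theorem inner_eq_ite_of_orthonormal_support {s : ℕ → ℝ} {u : ℕ → E}
    (hu : Orthonormal 𝕜 fun n : Function.support s => u n) (hu_zero : ∀ n, s n = 0 → u n = 0)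
    (i j : ℕ) : ⟪u i, u j⟫_𝕜 = if i = j ∧ s j ≠ 0 then 1 else 0 := by
  by_cases hi : s i = 0
  · rw [hu_zero i hi, inner_zero_left, if_neg]
    rintro ⟨rfl, hj⟩
    exact hj hi
  by_cases hj : s j = 0
  · simp [hj, hu_zero]
  simpa [hj, Subtype.ext_iff] using orthonormal_iff_ite.1 hu ⟨i, hi⟩ ⟨j, hj⟩

namespace IsSchmidtExpansion

variable {a : E →L[𝕜] F} {s : ℕ → ℝ} {u : ℕ → F} {v : ℕ → E}

theorem nonneg (h : IsSchmidtExpansion a s u v) (n : ℕ) : 0 ≤ s n :=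
  h.antitone.le_of_tendsto h.tendsto_zero n

theorem isBessel_left (h : IsSchmidtExpansion a s u v) : IsBessel 𝕜 u :=
  isBessel_of_orthonormal h.left_orthonormal fun n hn =>
    h.left_eq_zero n (Function.notMem_support.1 hn)

theorem isBessel_right (h : IsSchmidtExpansion a s u v) : IsBessel 𝕜 v :=
  isBessel_of_orthonormal h.right_orthonormal fun n hn =>
    h.right_eq_zero n (Function.notMem_support.1 hn)

theorem tendsto_apply (h : IsSchmidtExpansion a s u v) (x : E) :
    Tendsto (fun n => ∑ i ∈ Finset.range n, ((s i : 𝕜) * ⟪v i, x⟫_𝕜) • u i) atTop (𝓝 (a x)) := by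
  simpa [Function.comp_def, sum_apply, mul_smul] using
    ((ContinuousLinearMap.apply 𝕜 F x).continuous.tendsto a).comp h.tendsto_sum

theorem apply_right (h : IsSchmidtExpansion a s u v) (n : ℕ) : a (v n) = (s n : 𝕜) • u n := by
  refine tendsto_nhds_unique (h.tendsto_apply (v n))
    (tendsto_atTop_of_eventually_const (i₀ := n + 1) fun N hN => ?_)
  rw [Finset.sum_eq_single_of_mem n (Finset.mem_range.2 hN)]
  · rw [inner_eq_ite_of_orthonormal_support h.right_orthonormal h.right_eq_zero]
    by_cases hn : s n = 0 <;> simp [hn]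
  · intro i _ hi
    simp [inner_eq_ite_of_orthonormal_support h.right_orthonormal h.right_eq_zero, hi]

theorem inner_left_apply (h : IsSchmidtExpansion a s u v) (n : ℕ) (x : E) :
    ⟪u n, a x⟫_𝕜 = s n * ⟪v n, x⟫_𝕜 := by
  refine tendsto_nhds_unique ((tendsto_const_nhds (x := u n)).inner (h.tendsto_apply x))
    (tendsto_atTop_of_eventually_const (i₀ := n + 1) fun N hN => ?_)
  rw [inner_sum, Finset.sum_eq_single_of_mem n (Finset.mem_range.2 hN)]
  · rw [inner_smul_right,
      inner_eq_ite_of_orthonormal_support h.left_orthonormal h.left_eq_zero]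
    by_cases hn : s n = 0 <;> simp [hn]
  · intro i _ hi
    simp [inner_smul_right,
      inner_eq_ite_of_orthonormal_support h.left_orthonormal h.left_eq_zero, hi.symm]

theorem inner_left_apply_right (h : IsSchmidtExpansion a s u v) (n : ℕ) :
    ⟪u n, a (v n)⟫_𝕜 = s n := by
  rw [h.inner_left_apply,
    inner_eq_ite_of_orthonormal_support h.right_orthonormal h.right_eq_zero]
  by_cases hn : s n = 0 <;> simp [hn]

theorem enorm_inner_apply_le (h : IsSchmidtExpansion a s u v) (x : E) (y : F) :
    ‖⟪y, a x⟫_𝕜‖ₑ ≤ ∑' n, ENNReal.ofReal (s n) * (‖⟪u n, y⟫_𝕜‖ₑ * ‖⟪v n, x⟫_𝕜‖ₑ) := by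
  have hlim := ((tendsto_const_nhds (x := y)).inner (𝕜 := 𝕜) (h.tendsto_apply x)).enorm
  refine le_of_tendsto' hlim fun N => ?_
  rw [inner_sum]
  refine (enorm_sum_le _ _).trans ((Finset.sum_le_sum fun n _ => ?_).trans (ENNReal.sum_le_tsum _))
  rw [inner_smul_right, enorm_mul, enorm_mul, enorm_inner_comm y (u n), ← ofReal_norm (s n : 𝕜),
    RCLike.norm_of_nonneg (h.nonneg n)]
  exact (by ring : _ = _).le

end IsSchmidtExpansion

end SchmidtExpansion

section EigenvalueSeq

variable {H : Type*} [NormedAddCommGroup H] [InnerProductSpace ℂ H] {b : H →L[ℂ] H} {s : ℕ → ℝ}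
  {e : ℕ → H}

theorem mem_spectralSpan_of_apply_eq_smul {t μ : ℝ} (hμ : t < μ) {x : H}
    (hx : b x = (μ : ℂ) • x) : x ∈ spectralSpan b t :=
  Submodule.mem_iSup_of_mem ⟨μ, hμ⟩ (Module.End.mem_eigenspace_iff.2 hx)

namespace IsSchmidtExpansion

theorem natCast_lt_rank_spectralSpan (h : IsSchmidtExpansion b s e e) {t : ℝ} {n : ℕ}
    (ht : 0 ≤ t) (htn : t < s n) : (n : Cardinal) < Module.rank ℂ (spectralSpan b t) := by
  have hlt : ∀ i : Fin (n + 1), t < s i := fun i => htn.trans_le (h.antitone i.is_le)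
  have horth : Orthonormal ℂ fun i : Fin (n + 1) => e (i : ℕ) :=
    h.right_orthonormal.comp (fun i : Fin (n + 1) => ⟨i, (ht.trans_lt (hlt i)).ne'⟩)
      fun _ _ hij => Fin.ext (congrArg Subtype.val hij)
  let w : Fin (n + 1) → spectralSpan b t := fun i =>
    ⟨e i, mem_spectralSpan_of_apply_eq_smul (hlt i) (h.apply_right i)⟩
  have hw : LinearIndependent ℂ w :=
    .of_comp (spectralSpan b t).subtype horth.linearIndependent
  have hcard := hw.cardinal_lift_le_rank
  rw [Cardinal.mk_fin, Cardinal.lift_natCast, Cardinal.lift_uzero] at hcard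
  exact (by exact_mod_cast n.lt_succ_self : (n : Cardinal) < (n + 1 : ℕ)).trans_le hcard

theorem spectralSpan_le_span (h : IsSchmidtExpansion b s e e) {t : ℝ} {n : ℕ}
    (ht : s n ≤ t) :
    spectralSpan b t ≤ Submodule.span ℂ (e '' Set.Iio n) := by
  refine iSup_le fun ⟨μ, hμ⟩ x hx => ?_
  have hbx : b x = (μ : ℂ) • x := Module.End.mem_eigenspace_iff.1 hx
  have hμ_ne : (μ : ℂ) ≠ 0 := by exact_mod_cast ((h.nonneg n).trans_lt (ht.trans_lt hμ)).ne'
  have hinner : ∀ m ≥ n, ⟪e m, x⟫_ℂ = 0 := by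
    intro m hm
    have hsm : (μ : ℂ) ≠ s m := by
      exact_mod_cast ((h.antitone hm).trans_lt (ht.trans_lt hμ)).ne'
    have hcoord := h.inner_left_apply m x
    rw [hbx, inner_smul_right] at hcoord
    exact (mul_eq_mul_right_iff.1 hcoord).resolve_left hsm
  have hsum : b x = ∑ i ∈ Finset.range n, ((s i : ℂ) * ⟪e i, x⟫_ℂ) • e i :=
    tendsto_nhds_unique (h.tendsto_apply x) <|
      tendsto_atTop_of_eventually_const (i₀ := n) fun N hN =>
        (Finset.sum_subset (Finset.range_mono hN) fun i _ hi => by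
          simp [hinner i (by simpa using hi)]).symm
  rw [← Submodule.smul_mem_iff _ hμ_ne, ← hbx, hsum]
  exact Submodule.sum_mem _ fun i hi => Submodule.smul_mem _ _
    (Submodule.subset_span (Set.mem_image_of_mem e (Finset.mem_range.1 hi)))

theorem rank_spectralSpan_le_iff (h : IsSchmidtExpansion b s e e) {t : ℝ} (ht : 0 ≤ t) (n : ℕ) :
    Module.rank ℂ (spectralSpan b t) ≤ n ↔ s n ≤ t := by
  refine ⟨fun hrank => ?_, fun hst => ?_⟩
  · by_contra! hlt
    exact hrank.not_gt (h.natCast_lt_rank_spectralSpan ht hlt)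
  · calc Module.rank ℂ (spectralSpan b t)
        ≤ Module.rank ℂ (Submodule.span ℂ (e '' Set.Iio n)) :=
          Submodule.rank_mono (h.spectralSpan_le_span hst)
      _ ≤ Cardinal.mk (e '' Set.Iio n) := rank_span_le _
      _ ≤ n := by simpa using Cardinal.mk_image_le_lift (f := e) (s := Set.Iio n)

theorem eigenvalueSeq_eq (h : IsSchmidtExpansion b s e e) : eigenvalueSeq b = s := by
  funext n
  have hset : {t : ℝ | 0 ≤ t ∧ Module.rank ℂ (spectralSpan b t) ≤ n} = Set.Ici (s n) :=
    Set.ext fun t => ⟨fun ⟨ht, hrank⟩ => (h.rank_spectralSpan_le_iff ht n).1 hrank,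
      fun ht => ⟨(h.nonneg n).trans ht,
        (h.rank_spectralSpan_le_iff ((h.nonneg n).trans ht) n).2 ht⟩⟩
  rw [eigenvalueSeq, hset, csInf_Ici]

end IsSchmidtExpansion

end EigenvalueSeq

section Polar

variable {𝕜 E F G : Type*} [RCLike 𝕜] [NormedAddCommGroup E] [InnerProductSpace 𝕜 E]
  [NormedAddCommGroup F] [InnerProductSpace 𝕜 F] [NormedAddCommGroup G] [InnerProductSpace 𝕜 G]
  {s : ℕ → ℝ} {v : ℕ → E}

theorem sum_smul_rankOne_eq_comp {a : E →L[𝕜] F} {u : ℕ → F}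
    (hav : ∀ i, a (v i) = (s i : 𝕜) • u i) (t : Finset ℕ) :
    ∑ i ∈ t, (s i : 𝕜) • InnerProductSpace.rankOne 𝕜 (u i) (v i) =
      a ∘L ∑ i ∈ t, InnerProductSpace.rankOne 𝕜 (v i) (v i) := by
  ext x
  simp [sum_apply, hav, smul_comm (s _ : 𝕜)]

/-- Operators with the same absolute value have the same singular values and right singular
vectors. -/
theorem IsSchmidtExpansion.of_inner_apply_apply_eq {a : E →L[𝕜] F} {b : E →L[𝕜] G} {u : ℕ → G}
    (h : IsSchmidtExpansion b s u v) (hab : ∀ x y, ⟪a x, a y⟫_𝕜 = ⟪b x, b y⟫_𝕜) :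
    IsSchmidtExpansion a s (fun n => (s n : 𝕜)⁻¹ • a (v n)) v where
  antitone := h.antitone
  tendsto_zero := h.tendsto_zero
  left_orthonormal := by
    have hleft : ∀ n : Function.support s, u n = (s n : 𝕜)⁻¹ • b (v n) := fun n => by
      rw [h.apply_right, inv_smul_smul₀ (by exact_mod_cast n.2)]
    rw [orthonormal_iff_ite]
    simpa only [hleft, inner_smul_left, inner_smul_right, hab] using
      orthonormal_iff_ite.1 h.left_orthonormal
  left_eq_zero n hn := by simp [hn]
  right_orthonormal := h.right_orthonormal
  right_eq_zero := h.right_eq_zero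
  tendsto_sum := by
    have hav : ∀ n, a (v n) = (s n : 𝕜) • (s n : 𝕜)⁻¹ • a (v n) := fun n => by
      by_cases hn : s n = 0
      · simp [hn, h.right_eq_zero]
      · rw [smul_inv_smul₀ (by exact_mod_cast hn)]
    have hnorm : ∀ x, ‖a x‖ = ‖b x‖ := fun x => by
      rw [@norm_eq_sqrt_re_inner 𝕜, @norm_eq_sqrt_re_inner 𝕜, hab]
    have htail := tendsto_iff_norm_sub_tendsto_zero.1 h.tendsto_sum
    refine tendsto_iff_norm_sub_tendsto_zero.2 (htail.congr fun n => ?_)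
    rw [sum_smul_rankOne_eq_comp h.apply_right, sum_smul_rankOne_eq_comp hav]
    refine ContinuousLinearMap.opNorm_ext _ _ fun x => ?_
    simp only [sub_apply, ContinuousLinearMap.comp_apply, ← map_sub, hnorm]

end Polar

section Deflation

variable {H : Type*} [NormedAddCommGroup H] [InnerProductSpace ℂ H]

/-- A unit eigenvector of the positive compact operator `b` for its largest eigenvalue `‖b‖`, and
the zero vector if `b = 0`. -/
def topEigenvector (b : H →L[ℂ] H) : H :=
  Classical.epsilon fun e => b e = (‖b‖ : ℂ) • e ∧ (b = 0 → e = 0) ∧ (b ≠ 0 → ‖e‖ = 1)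

/-- The orthogonal projection onto the line spanned by `topEigenvector b`. -/
def topProjection (b : H →L[ℂ] H) : H →L[ℂ] H :=
  InnerProductSpace.rankOne ℂ (topEigenvector b) (topEigenvector b)

/-- The operator that remains of the positive compact operator `b` once the eigenvector
`topEigenvector b` is split off. Its iterates produce the eigenvalues of `b` in decreasing order. -/
def deflate (b : H →L[ℂ] H) : H →L[ℂ] H :=
  b - (‖b‖ : ℂ) • topProjection b

theorem deflate_iterate_add_sum (b : H →L[ℂ] H) (n : ℕ) :
    deflate^[n] b + ∑ i ∈ Finset.range n, (‖deflate^[i] b‖ : ℂ) • topProjection (deflate^[i] b) =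
      b := by
  induction n with
  | zero => simp
  | succ n ih =>
    rw [Function.iterate_succ_apply', deflate, Finset.sum_range_succ, add_comm (Finset.sum _ _),
      ← add_assoc, sub_add_cancel, ih]

variable [CompleteSpace H] {b : H →L[ℂ] H}

theorem exists_eigenvector_norm (hb : 0 ≤ b) (hc : IsCompactOperator b) (hb_ne : b ≠ 0) :
    ∃ e : H, b e = (‖b‖ : ℂ) • e ∧ ‖e‖ = 1 := by
  have : Nontrivial H := by
    by_contra hH
    rw [not_nontrivial_iff_subsingleton] at hH
    exact hb_ne (Subsingleton.elim _ _)
  have hspec : (‖b‖ : ℂ) ∈ spectrum ℂ b :=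
    (spectrum.algebraMap_mem_iff ℂ).2 (CStarAlgebra.norm_mem_spectrum_of_nonneg hb)
  have hnorm_ne : (‖b‖ : ℂ) ≠ 0 := by exact_mod_cast norm_ne_zero_iff.2 hb_ne
  obtain ⟨x, hx⟩ :=
    ((hc.hasEigenvalue_iff_mem_spectrum hnorm_ne).2 hspec).exists_hasEigenvector
  have hbx : b x = (‖b‖ : ℂ) • x := hx.apply_eq_smul
  refine ⟨(‖x‖ : ℂ)⁻¹ • x, by rw [map_smul, hbx, smul_comm], by simp [norm_smul, hx.2]⟩

theorem topEigenvector_spec (hb : 0 ≤ b) (hc : IsCompactOperator b) :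
    b (topEigenvector b) = (‖b‖ : ℂ) • topEigenvector b ∧
      (b = 0 → topEigenvector b = 0) ∧ (b ≠ 0 → ‖topEigenvector b‖ = 1) := by
  refine Classical.epsilon_spec
    (p := fun e => b e = (‖b‖ : ℂ) • e ∧ (b = 0 → e = 0) ∧ (b ≠ 0 → ‖e‖ = 1)) ?_
  by_cases hb_zero : b = 0
  · exact ⟨0, by simp [hb_zero]⟩
  · simpa [hb_zero] using exists_eigenvector_norm hb hc hb_zero

theorem apply_topEigenvector (hb : 0 ≤ b) (hc : IsCompactOperator b) :
    b (topEigenvector b) = (‖b‖ : ℂ) • topEigenvector b :=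
  (topEigenvector_spec hb hc).1

theorem topEigenvector_zero : topEigenvector (0 : H →L[ℂ] H) = 0 :=
  (topEigenvector_spec le_rfl isCompactOperator_zero).2.1 rfl

theorem norm_topEigenvector (hb : 0 ≤ b) (hc : IsCompactOperator b) (hb_ne : b ≠ 0) :
    ‖topEigenvector b‖ = 1 :=
  (topEigenvector_spec hb hc).2.2 hb_ne

theorem isStarProjection_topProjection (hb : 0 ≤ b) (hc : IsCompactOperator b) :
    IsStarProjection (topProjection b) := by
  by_cases hb_zero : b = 0
  · simp [hb_zero, topProjection, topEigenvector_zero, IsStarProjection.zero]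
  · exact InnerProductSpace.isStarProjection_rankOne_self (norm_topEigenvector hb hc hb_zero)

theorem mul_topProjection (hb : 0 ≤ b) (hc : IsCompactOperator b) :
    b * topProjection b = (‖b‖ : ℂ) • topProjection b := by
  ext x
  change b (⟪topEigenvector b, x⟫_ℂ • topEigenvector b) =
    (‖b‖ : ℂ) • ⟪topEigenvector b, x⟫_ℂ • topEigenvector b
  rw [map_smul, apply_topEigenvector hb hc, smul_comm]

theorem topProjection_mul (hb : 0 ≤ b) (hc : IsCompactOperator b) :
    topProjection b * b = (‖b‖ : ℂ) • topProjection b := by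
  simpa [hb.isSelfAdjoint.star_eq, (isStarProjection_topProjection hb hc).isSelfAdjoint.star_eq]
    using congrArg star (mul_topProjection hb hc)

theorem topProjection_apply_topEigenvector (hb : 0 ≤ b) (hc : IsCompactOperator b) :
    topProjection b (topEigenvector b) = topEigenvector b := by
  by_cases hb_zero : b = 0
  · simp [hb_zero, topEigenvector_zero]
  · simp [topProjection, norm_topEigenvector hb hc hb_zero]

theorem deflate_eq_conjugate (hb : 0 ≤ b) (hc : IsCompactOperator b) :
    deflate b = (1 - topProjection b) * b * (1 - topProjection b) := by
  have hp := (isStarProjection_topProjection hb hc).isIdempotentElem.eq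
  simp only [deflate, sub_mul, mul_sub, one_mul, mul_one, mul_topProjection hb hc,
    topProjection_mul hb hc, smul_mul_assoc, hp]
  abel

theorem deflate_nonneg (hb : 0 ≤ b) (hc : IsCompactOperator b) : 0 ≤ deflate b := by
  have hp := (isStarProjection_topProjection hb hc).one_sub.isSelfAdjoint.star_eq
  rw [deflate_eq_conjugate hb hc]
  simpa only [hp] using star_left_conjugate_nonneg hb (1 - topProjection b)

theorem isCompactOperator_deflate (hb : 0 ≤ b) (hc : IsCompactOperator b) :
    IsCompactOperator (deflate b) := by
  rw [deflate_eq_conjugate hb hc]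
  exact (hc.clm_comp (1 - topProjection b)).comp_clm (1 - topProjection b)

theorem norm_deflate_le (hb : 0 ≤ b) (hc : IsCompactOperator b) : ‖deflate b‖ ≤ ‖b‖ := by
  refine CStarAlgebra.norm_le_norm_of_nonneg_of_le (deflate_nonneg hb hc) (sub_le_self b ?_)
  rw [Complex.coe_smul]
  exact smul_nonneg (norm_nonneg b) (isStarProjection_topProjection hb hc).nonneg

theorem deflate_apply_topEigenvector (hb : 0 ≤ b) (hc : IsCompactOperator b) :
    deflate b (topEigenvector b) = 0 := by
  simp [deflate, apply_topEigenvector hb hc, topProjection_apply_topEigenvector hb hc]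

theorem deflate_apply_eq_zero (hb : 0 ≤ b) (hc : IsCompactOperator b) {x : H} (hx : b x = 0) :
    deflate b x = 0 := by
  have hproj : (‖b‖ : ℂ) • topProjection b x = topProjection b (b x) :=
    (DFunLike.congr_fun (topProjection_mul hb hc) x).symm
  rw [deflate, sub_apply, smul_apply, hproj, hx, map_zero, sub_zero]

theorem deflate_iterate_nonneg_and_isCompactOperator (hb : 0 ≤ b) (hc : IsCompactOperator b)
    (n : ℕ) : 0 ≤ deflate^[n] b ∧ IsCompactOperator (deflate^[n] b) := by
  induction n with
  | zero => exact ⟨hb, hc⟩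
  | succ n ih =>
    rw [Function.iterate_succ_apply']
    exact ⟨deflate_nonneg ih.1 ih.2, isCompactOperator_deflate ih.1 ih.2⟩

theorem deflate_iterate_apply_topEigenvector (hb : 0 ≤ b) (hc : IsCompactOperator b) {m n : ℕ}
    (hmn : m < n) : deflate^[n] b (topEigenvector (deflate^[m] b)) = 0 := by
  induction n, hmn using Nat.le_induction with
  | base =>
    obtain ⟨hpos, hcomp⟩ := deflate_iterate_nonneg_and_isCompactOperator hb hc m
    rw [Function.iterate_succ_apply', deflate_apply_topEigenvector hpos hcomp]
  | succ n _ ih =>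
    obtain ⟨hpos, hcomp⟩ := deflate_iterate_nonneg_and_isCompactOperator hb hc n
    rw [Function.iterate_succ_apply', deflate_apply_eq_zero hpos hcomp ih]

theorem inner_topEigenvector_deflate_iterate (hb : 0 ≤ b) (hc : IsCompactOperator b) {m n : ℕ}
    (hmn : m < n) :
    ⟪topEigenvector (deflate^[m] b), topEigenvector (deflate^[n] b)⟫_ℂ = 0 := by
  obtain ⟨hpos, hcomp⟩ := deflate_iterate_nonneg_and_isCompactOperator hb hc n
  by_cases h_zero : deflate^[n] b = 0
  · simp [h_zero, topEigenvector_zero]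
  have hsymm := hpos.isSelfAdjoint.isSymmetric (topEigenvector (deflate^[m] b))
    (topEigenvector (deflate^[n] b))
  rw [ContinuousLinearMap.coe_coe, deflate_iterate_apply_topEigenvector hb hc hmn,
    apply_topEigenvector hpos hcomp, inner_zero_left, inner_smul_right, eq_comm] at hsymm
  exact (mul_eq_zero.1 hsymm).resolve_left (by exact_mod_cast norm_ne_zero_iff.2 h_zero)

theorem apply_topEigenvector_deflate_iterate (hb : 0 ≤ b) (hc : IsCompactOperator b) (n : ℕ) :
    b (topEigenvector (deflate^[n] b)) =
      (‖deflate^[n] b‖ : ℂ) • topEigenvector (deflate^[n] b) := by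
  obtain ⟨hpos, hcomp⟩ := deflate_iterate_nonneg_and_isCompactOperator hb hc n
  have hsum := DFunLike.congr_fun (deflate_iterate_add_sum b n) (topEigenvector (deflate^[n] b))
  rw [← hsum, add_apply, sum_apply, Finset.sum_eq_zero, add_zero, apply_topEigenvector hpos hcomp]
  intro i hi
  simp [topProjection, inner_topEigenvector_deflate_iterate hb hc (Finset.mem_range.1 hi)]

theorem orthonormal_topEigenvector_deflate_iterate (hb : 0 ≤ b) (hc : IsCompactOperator b) :
    Orthonormal ℂ fun n : Function.support fun n => ‖deflate^[n] b‖ =>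
      topEigenvector (deflate^[n] b) := by
  refine ⟨fun ⟨n, hn⟩ => ?_, fun ⟨m, _⟩ ⟨n, _⟩ hmn => ?_⟩
  · obtain ⟨hpos, hcomp⟩ := deflate_iterate_nonneg_and_isCompactOperator hb hc n
    exact norm_topEigenvector hpos hcomp (norm_ne_zero_iff.1 hn)
  · rcases lt_or_gt_of_ne (Subtype.coe_ne_coe.2 hmn) with hlt | hlt
    · exact inner_topEigenvector_deflate_iterate hb hc hlt
    · exact inner_eq_zero_symm.1 (inner_topEigenvector_deflate_iterate hb hc hlt)

theorem topEigenvector_eq_zero_of_norm_eq_zero (hb : ‖b‖ = 0) : topEigenvector b = 0 := by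
  rw [norm_eq_zero.1 hb, topEigenvector_zero]

theorem tendsto_norm_deflate_iterate (hb : 0 ≤ b) (hc : IsCompactOperator b) :
    Tendsto (fun n => ‖deflate^[n] b‖) atTop (𝓝 0) := by
  have hbessel : IsBessel ℂ fun n => topEigenvector (deflate^[n] b) :=
    isBessel_of_orthonormal (orthonormal_topEigenvector_deflate_iterate hb hc) fun n hn =>
      topEigenvector_eq_zero_of_norm_eq_zero (Function.notMem_support.1 hn)
  refine (tendsto_zero_iff_norm_tendsto_zero.1 (hbessel.tendsto_apply hc)).congr fun n => ?_
  obtain ⟨hpos, hcomp⟩ := deflate_iterate_nonneg_and_isCompactOperator hb hc n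
  rw [apply_topEigenvector_deflate_iterate hb hc, norm_smul, Complex.norm_real, norm_norm]
  by_cases h_zero : deflate^[n] b = 0
  · simp [h_zero]
  · rw [norm_topEigenvector hpos hcomp h_zero, mul_one]

theorem isSchmidtExpansion_deflate_iterate (hb : 0 ≤ b) (hc : IsCompactOperator b) :
    IsSchmidtExpansion b (fun n => ‖deflate^[n] b‖) (fun n => topEigenvector (deflate^[n] b))
      (fun n => topEigenvector (deflate^[n] b)) where
  antitone := antitone_nat_of_succ_le fun n => by
    obtain ⟨hpos, hcomp⟩ := deflate_iterate_nonneg_and_isCompactOperator hb hc n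
    rw [Function.iterate_succ_apply']
    exact norm_deflate_le hpos hcomp
  tendsto_zero := tendsto_norm_deflate_iterate hb hc
  left_orthonormal := orthonormal_topEigenvector_deflate_iterate hb hc
  left_eq_zero _ := topEigenvector_eq_zero_of_norm_eq_zero
  right_orthonormal := orthonormal_topEigenvector_deflate_iterate hb hc
  right_eq_zero _ := topEigenvector_eq_zero_of_norm_eq_zero
  tendsto_sum := by
    refine tendsto_iff_norm_sub_tendsto_zero.2 ((tendsto_norm_deflate_iterate hb hc).congr
      fun n => ?_)
    rw [norm_sub_rev]
    exact congrArg norm (eq_sub_of_add_eq (deflate_iterate_add_sum b n))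

theorem exists_isSchmidtExpansion {a : H →L[ℂ] H} (ha : IsCompactOperator a) :
    ∃ (u v : ℕ → H), IsSchmidtExpansion a (eigenvalueSeq (CFC.abs a)) u v := by
  have habs := isSchmidtExpansion_deflate_iterate (CFC.abs_nonneg a) (isCompactOperator_abs ha)
  rw [← habs.eigenvalueSeq_eq] at habs
  exact ⟨_, _, habs.of_inner_apply_apply_eq fun x y => (inner_abs_apply_abs_apply a x y).symm⟩

end Deflation

section Summation

theorem tsum_ofReal_sub_succ {s : ℕ → ℝ} (hs : Antitone s) (hs_zero : Tendsto s atTop (𝓝 0)) :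
    ∑' n, ENNReal.ofReal (s n - s (n + 1)) = ENNReal.ofReal (s 0) := by
  have hnonneg : ∀ n, 0 ≤ s n - s (n + 1) := fun n => sub_nonneg.2 (hs n.le_succ)
  have hsum : HasSum (fun n => s n - s (n + 1)) (s 0) := by
    rw [hasSum_iff_tendsto_nat_of_nonneg hnonneg]
    simpa only [Finset.sum_range_sub', sub_zero] using hs_zero.const_sub (s 0)
  rw [← ENNReal.ofReal_tsum_of_nonneg hnonneg hsum.summable, hsum.tsum_eq]

theorem tsum_tsum_add_mul (σ c : ℕ → ℝ≥0∞) :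
    ∑' n, (∑' k, σ (n + k)) * c n = ∑' m, σ m * ∑ n ∈ Finset.range (m + 1), c n := by
  calc ∑' n, (∑' k, σ (n + k)) * c n = ∑' p : ℕ × ℕ, σ (p.1 + p.2) * c p.1 := by
        simp only [ENNReal.tsum_prod', ENNReal.tsum_mul_right]
    _ = ∑' m, ∑ p ∈ Finset.HasAntidiagonal.antidiagonal m, σ (p.1 + p.2) * c p.1 := by
        rw [← Finset.HasAntidiagonal.sigmaAntidiagonalEquivProd.tsum_eq, ENNReal.tsum_sigma']
        exact tsum_congr fun m => Finset.tsum_subtype (Finset.HasAntidiagonal.antidiagonal m)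
          fun p : ℕ × ℕ => σ (p.1 + p.2) * c p.1
    _ = ∑' m, σ m * ∑ n ∈ Finset.range (m + 1), c n := by
        refine tsum_congr fun m => ?_
        rw [Finset.Nat.sum_antidiagonal_eq_sum_range_succ fun i j => σ (i + j) * c i,
          Finset.mul_sum]
        refine Finset.sum_congr rfl fun n hn => ?_
        rw [Nat.add_sub_cancel' (Finset.mem_range_succ_iff.1 hn)]

theorem tsum_ofReal_mul_eq_tsum_sub_mul_sum {s : ℕ → ℝ} (hs : Antitone s)
    (hs_zero : Tendsto s atTop (𝓝 0)) (c : ℕ → ℝ≥0∞) :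
    ∑' n, ENNReal.ofReal (s n) * c n =
      ∑' m, ENNReal.ofReal (s m - s (m + 1)) * ∑ n ∈ Finset.range (m + 1), c n := by
  rw [← tsum_tsum_add_mul]
  refine tsum_congr fun n => ?_
  congr 1
  exact (tsum_ofReal_sub_succ (s := fun k => s (n + k)) (fun i j hij => hs (by gcongr))
    (hs_zero.comp (tendsto_add_atTop_nat n |>.congr fun k => add_comm k n))).symm

theorem tsum_mul_le_sum_range {d : ℕ → ℝ≥0} (hd : Antitone d) {c : ℕ → ℝ≥0∞} (hc : ∀ i, c i ≤ 1)
    {m : ℕ} (hcm : ∑' i, c i ≤ m) : ∑' i, d i * c i ≤ ∑ i ∈ Finset.range m, (d i : ℝ≥0∞) := by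
  have hterm : ∀ i, d i * c i ≤
      d m * c i + if i ∈ Finset.range m then ((d i - d m : ℝ≥0) : ℝ≥0∞) else 0 := by
    intro i
    split_ifs with hi
    · calc d i * c i = d m * c i + (d i - d m : ℝ≥0) * c i := by
            rw [← add_mul, ← ENNReal.coe_add, add_tsub_cancel_of_le (hd (Finset.mem_range.1 hi).le)]
        _ ≤ d m * c i + (d i - d m : ℝ≥0) := by gcongr; exact mul_le_of_le_one_right' (hc i)
    · rw [add_zero]
      gcongr
      exact hd (not_lt.1 (Finset.mem_range.not.1 hi))
  calc ∑' i, d i * c i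
      ≤ d m * ∑' i, c i + ∑ i ∈ Finset.range m, ((d i - d m : ℝ≥0) : ℝ≥0∞) := by
        refine (ENNReal.tsum_le_tsum hterm).trans_eq ?_
        rw [ENNReal.tsum_add, ENNReal.tsum_mul_left, sum_eq_tsum_indicator]
        simp only [Set.indicator_apply, Finset.mem_coe]
    _ ≤ d m * m + ∑ i ∈ Finset.range m, ((d i - d m : ℝ≥0) : ℝ≥0∞) := by gcongr
    _ = ∑ i ∈ Finset.range m, (d i : ℝ≥0∞) := by
        rw [mul_comm, ← nsmul_eq_mul, ← Finset.card_range m, ← Finset.sum_const, Finset.card_range,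
          ← Finset.sum_add_distrib]
        refine Finset.sum_congr rfl fun i hi => ?_
        rw [← ENNReal.coe_add, add_tsub_cancel_of_le (hd (Finset.mem_range.1 hi).le)]

end Summation

section BesselNorm

variable {𝕜 E F G ι : Type*} [RCLike 𝕜] [NormedAddCommGroup E] [InnerProductSpace 𝕜 E]
  [NormedAddCommGroup F] [InnerProductSpace 𝕜 F] [NormedAddCommGroup G] [InnerProductSpace 𝕜 G]

/-- The dual description of the norm with weights `d`: the largest value of
`∑ i, d i * |⟨f i, a (e i)⟩|` over Bessel families `e` and `f`. As a supremum of seminorms it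
makes the triangle inequality and lower semicontinuity evident. -/
def besselNorm (d : ι → ℝ≥0) (a : E →L[𝕜] F) : ℝ≥0∞ :=
  ⨆ (e : {e : ι → E // IsBessel 𝕜 e}) (f : {f : ι → F // IsBessel 𝕜 f}),
    ∑' i, d i * ‖⟪f.1 i, a (e.1 i)⟫_𝕜‖ₑ

variable {d : ι → ℝ≥0}

theorem le_besselNorm (d : ι → ℝ≥0) (a : E →L[𝕜] F) {e : ι → E} {f : ι → F} (he : IsBessel 𝕜 e)
    (hf : IsBessel 𝕜 f) : ∑' i, d i * ‖⟪f i, a (e i)⟫_𝕜‖ₑ ≤ besselNorm d a :=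
  le_iSup₂_of_le (⟨e, he⟩ : {e : ι → E // IsBessel 𝕜 e})
    (⟨f, hf⟩ : {f : ι → F // IsBessel 𝕜 f}) le_rfl

theorem besselNorm_le {a : E →L[𝕜] F} {C : ℝ≥0∞}
    (h : ∀ (e : ι → E) (f : ι → F), IsBessel 𝕜 e → IsBessel 𝕜 f →
      ∑' i, d i * ‖⟪f i, a (e i)⟫_𝕜‖ₑ ≤ C) : besselNorm d a ≤ C :=
  iSup₂_le fun e f => h e f e.2 f.2

theorem besselNorm_add_le (d : ι → ℝ≥0) (a b : E →L[𝕜] F) :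
    besselNorm d (a + b) ≤ besselNorm d a + besselNorm d b := by
  refine besselNorm_le fun e f he hf => ?_
  calc ∑' i, d i * ‖⟪f i, (a + b) (e i)⟫_𝕜‖ₑ
      ≤ ∑' i, (d i * ‖⟪f i, a (e i)⟫_𝕜‖ₑ + d i * ‖⟪f i, b (e i)⟫_𝕜‖ₑ) := by
        refine ENNReal.tsum_le_tsum fun i => ?_
        rw [← mul_add, add_apply, inner_add_right]
        gcongr
        exact enorm_add_le _ _
    _ ≤ besselNorm d a + besselNorm d b := by
        rw [ENNReal.tsum_add]
        exact add_le_add (le_besselNorm d a he hf) (le_besselNorm d b he hf)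

theorem besselNorm_smul (d : ι → ℝ≥0) (c : 𝕜) (a : E →L[𝕜] F) :
    besselNorm d (c • a) = ‖c‖ₑ * besselNorm d a := by
  simp only [besselNorm, ENNReal.mul_iSup, ← ENNReal.tsum_mul_left]
  simp only [smul_apply, inner_smul_right, enorm_mul, mul_left_comm]

theorem besselNorm_adjoint_le [CompleteSpace E] [CompleteSpace F] (d : ι → ℝ≥0) (a : E →L[𝕜] F) :
    besselNorm d a.adjoint ≤ besselNorm d a := by
  refine besselNorm_le fun e f he hf => ?_
  simpa only [ContinuousLinearMap.adjoint_inner_right, enorm_inner_comm (e _)] using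
    le_besselNorm d a hf he

theorem besselNorm_comp_le [CompleteSpace E] [CompleteSpace F] (d : ι → ℝ≥0) (a : F →L[𝕜] G)
    (b : E →L[𝕜] F) : besselNorm d (a ∘L b) ≤ ‖b‖ₑ * besselNorm d a := by
  rcases eq_or_ne b 0 with rfl | hb
  · exact besselNorm_le fun e f _ _ => by simp
  have hb_norm : (‖b‖ : 𝕜) ≠ 0 := by exact_mod_cast norm_ne_zero_iff.2 hb
  have hcontr : ‖(‖b‖ : 𝕜)⁻¹ • b‖ ≤ 1 := by simp [norm_smul, hb]
  calc besselNorm d (a ∘L b) = besselNorm d ((‖b‖ : 𝕜) • (a ∘L ((‖b‖ : 𝕜)⁻¹ • b))) := by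
        rw [← ContinuousLinearMap.comp_smul, smul_inv_smul₀ hb_norm]
    _ = ‖b‖ₑ * besselNorm d (a ∘L ((‖b‖ : 𝕜)⁻¹ • b)) := by
        rw [besselNorm_smul, ← ofReal_norm, RCLike.norm_ofReal, abs_norm, ofReal_norm]
    _ ≤ ‖b‖ₑ * besselNorm d a := by
        gcongr
        exact besselNorm_le fun e f he hf => le_besselNorm d a (he.map hcontr) hf

theorem exists_norm_le_one_norm_inner_eq (z : F) : ∃ y : F, ‖y‖ ≤ 1 ∧ ‖⟪y, z⟫_𝕜‖ = ‖z‖ := by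
  rcases eq_or_ne z 0 with rfl | hz
  · exact ⟨0, by simp⟩
  refine ⟨(‖z‖ : 𝕜)⁻¹ • z, by simp [norm_smul, hz], ?_⟩
  rw [inner_smul_left, norm_mul, inner_self_eq_norm_sq_to_K]
  have := norm_ne_zero_iff.2 hz
  simp [field]

theorem mul_enorm_le_besselNorm (d : ι → ℝ≥0) (i : ι) (a : E →L[𝕜] F) :
    d i * ‖a‖ₑ ≤ besselNorm d a := by
  classical
  refine ENNReal.mul_le_of_forall_lt fun t ht r hr => ?_
  lift r to ℝ≥0 using (hr.trans_le le_top).ne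
  obtain ⟨x, hx, hrx⟩ := a.exists_lt_apply_of_lt_opNNNorm (ENNReal.coe_lt_coe.1 hr)
  obtain ⟨y, hy, hyx⟩ := exists_norm_le_one_norm_inner_eq (𝕜 := 𝕜) (a x)
  calc t * r ≤ d i * ‖⟪y, a x⟫_𝕜‖ₑ := by
        rw [← ofReal_norm, hyx, ofReal_norm]
        gcongr
        exact ENNReal.coe_le_coe.2 hrx.le
    _ = d i * ‖⟪(Pi.single i y : ι → F) i, a ((Pi.single i x : ι → E) i)⟫_𝕜‖ₑ := by
        simp only [Pi.single_eq_same]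
    _ ≤ ∑' j, d j * ‖⟪(Pi.single i y : ι → F) j, a ((Pi.single i x : ι → E) j)⟫_𝕜‖ₑ :=
        ENNReal.le_tsum i
    _ ≤ besselNorm d a := le_besselNorm d a (isBessel_single i hx.le) (isBessel_single i hy)

theorem lowerSemicontinuous_besselNorm (d : ι → ℝ≥0) :
    LowerSemicontinuous fun a : E →L[𝕜] F => besselNorm d a :=
  lowerSemicontinuous_iSup fun e => lowerSemicontinuous_iSup fun f =>
    lowerSemicontinuous_tsum fun i => Continuous.lowerSemicontinuous <|
      (ENNReal.continuous_const_mul ENNReal.coe_ne_top).comp (by fun_prop)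

theorem IsSchmidtExpansion.besselNorm_eq {a : E →L[𝕜] F} {s : ℕ → ℝ} {u : ℕ → F} {v : ℕ → E}
    (h : IsSchmidtExpansion a s u v) {d : ℕ → ℝ≥0} (hd : Antitone d) :
    besselNorm d a =
      ∑' m, ENNReal.ofReal (s m - s (m + 1)) * ∑ n ∈ Finset.range (m + 1), (d n : ℝ≥0∞) := by
  refine le_antisymm (besselNorm_le fun e f he hf => ?_) ?_
  · let c (i n : ℕ) : ℝ≥0∞ := ‖⟪u n, f i⟫_𝕜‖ₑ * ‖⟪v n, e i⟫_𝕜‖ₑ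
    have hrow : ∀ m i, ∑ n ∈ Finset.range (m + 1), c i n ≤ 1 := fun m i =>
      (ENNReal.sum_le_tsum _).trans
        (h.isBessel_left.tsum_mul_le_one h.isBessel_right (hf.norm_le_one i) (he.norm_le_one i))
    have hcol : ∀ n, ∑' i, c i n ≤ 1 := fun n => by
      simpa only [c, enorm_inner_comm (u n), enorm_inner_comm (v n)] using hf.tsum_mul_le_one he
        (h.isBessel_left.norm_le_one n) (h.isBessel_right.norm_le_one n)
    have hmass : ∀ m, ∑' i, ∑ n ∈ Finset.range (m + 1), c i n ≤ (m + 1 : ℕ) := fun m => by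
      rw [Summable.tsum_finsetSum fun _ _ => ENNReal.summable]
      simpa using Finset.sum_le_card_nsmul (Finset.range (m + 1)) _ 1 fun n _ => hcol n
    calc ∑' i, d i * ‖⟪f i, a (e i)⟫_𝕜‖ₑ
        ≤ ∑' i, d i * ∑' n, ENNReal.ofReal (s n) * c i n := by
          gcongr with i
          exact h.enorm_inner_apply_le (e i) (f i)
      _ = ∑' m, ENNReal.ofReal (s m - s (m + 1)) *
            ∑' i, d i * ∑ n ∈ Finset.range (m + 1), c i n := by
          simp only [tsum_ofReal_mul_eq_tsum_sub_mul_sum h.antitone h.tendsto_zero,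
            ← ENNReal.tsum_mul_left]
          rw [ENNReal.tsum_comm]
          simp only [mul_left_comm]
      _ ≤ ∑' m, ENNReal.ofReal (s m - s (m + 1)) *
            ∑ n ∈ Finset.range (m + 1), (d n : ℝ≥0∞) := by
          gcongr with m
          exact tsum_mul_le_sum_range hd (hrow m) (hmass m)
  · rw [← tsum_ofReal_mul_eq_tsum_sub_mul_sum h.antitone h.tendsto_zero]
    refine le_trans (ENNReal.tsum_le_tsum fun n => ?_)
      (le_besselNorm d a h.isBessel_right h.isBessel_left)
    rw [h.inner_left_apply_right, ← ofReal_norm, RCLike.norm_ofReal, abs_of_nonneg (h.nonneg n),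
      mul_comm]

end BesselNorm

section Increments

/-- The weights `α (i + 1) - α i`, whose partial sums recover `α`. -/
def increments (α : ℕ → ℝ≥0) (i : ℕ) : ℝ≥0 :=
  α (i + 1) - α i

variable {α : ℕ → ℝ≥0}

theorem sum_increments (hα0 : α 0 = 0) (hα : Monotone α) (n : ℕ) :
    ∑ i ∈ Finset.range n, increments α i = α n := by
  simp only [increments]
  rw [Finset.sum_range_tsub hα, hα0, tsub_zero]

theorem antitone_increments (hα : Monotone α)
    (hconc : ∀ i : ℕ, (α (i + 2) + α i) / 2 ≤ α (i + 1)) : Antitone (increments α) := by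
  refine antitone_nat_of_succ_le fun i => ?_
  have h := NNReal.coe_le_coe.2 (hconc i)
  rw [increments, increments, ← NNReal.coe_le_coe, NNReal.coe_sub (hα i.le_succ),
    NNReal.coe_sub (hα (i + 1).le_succ)]
  push_cast at h
  linarith

theorem choquetENorm_eq_besselNorm {H : Type*} [NormedAddCommGroup H] [InnerProductSpace ℂ H]
    [CompleteSpace H] (hα0 : α 0 = 0) (hα : Monotone α)
    (hconc : ∀ i : ℕ, (α (i + 2) + α i) / 2 ≤ α (i + 1)) {a : H →L[ℂ] H}
    (ha : IsCompactOperator a) : choquetENorm α a = besselNorm (increments α) a := by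
  obtain ⟨u, v, h⟩ := exists_isSchmidtExpansion ha
  rw [h.besselNorm_eq (antitone_increments hα hconc), choquetENorm, choquetTrace]
  simp only [← sum_increments hα0 hα, ENNReal.ofNNReal_finsetSum]

end Increments

section Completeness

theorem tendsto_apply_sub_of_lowerSemicontinuous {X : Type*} [AddGroup X] [TopologicalSpace X]
    [ContinuousSub X] {N : X → ℝ≥0∞} (hN : LowerSemicontinuous N) {u : ℕ → X} {x : X}
    (hu : Tendsto u atTop (𝓝 x))
    (hcauchy : ∀ ε > 0, ∃ n₀, ∀ m ≥ n₀, ∀ n ≥ n₀, N (u m - u n) ≤ ε) :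
    Tendsto (fun n => N (u n - x)) atTop (𝓝 0) := by
  refine ENNReal.tendsto_atTop_zero.2 fun ε hε => ?_
  obtain ⟨n₀, hn₀⟩ := hcauchy ε hε
  refine ⟨n₀, fun n hn => (hN.isClosed_preimage ε).mem_of_tendsto (hu.const_sub (u n)) ?_⟩
  filter_upwards [eventually_ge_atTop n₀] with m hm
  exact hn₀ n hn m hm

variable {𝕜 : Type*} [NormedField 𝕜]

variable (𝕜) in
/-- A seminorm that may take the value `∞`. -/
structure IsExtendedSeminorm {X : Type*} [AddCommGroup X] [Module 𝕜 X] (N : X → ℝ≥0∞) : Prop where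
  add_le : ∀ x y, N (x + y) ≤ N x + N y
  smul : ∀ (c : 𝕜) x, N (c • x) = ‖c‖ₑ * N x

namespace IsExtendedSeminorm

section Module

variable {X : Type*} [AddCommGroup X] [Module 𝕜 X] {N : X → ℝ≥0∞}

/-- The elements of the submodule `K` at which the extended seminorm `N` is finite. -/
def finiteSubmodule (hN : IsExtendedSeminorm 𝕜 N) (K : Submodule 𝕜 X) : Submodule 𝕜 X where
  carrier := {x | x ∈ K ∧ N x < ∞}
  zero_mem' := ⟨K.zero_mem, by simpa using (hN.smul 0 0).trans_lt (by simp)⟩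
  add_mem' hx hy := ⟨K.add_mem hx.1 hy.1,
    (hN.add_le _ _).trans_lt (ENNReal.add_lt_top.2 ⟨hx.2, hy.2⟩)⟩
  smul_mem' c x hx := ⟨K.smul_mem c hx.1,
    (hN.smul c x).trans_lt (ENNReal.mul_lt_top enorm_lt_top hx.2)⟩

theorem normedSpaceCore (hN : IsExtendedSeminorm 𝕜 N) (hN_top : ∀ x, N x ≠ ∞)
    (hN_zero : ∀ x, N x = 0 → x = 0) :
    letI : Norm X := ⟨fun x => (N x).toReal⟩
    NormedSpace.Core 𝕜 X :=
  letI : Norm X := ⟨fun x => (N x).toReal⟩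
  { norm_nonneg := fun _ => ENNReal.toReal_nonneg
    norm_smul := fun c x => by simp [Norm.norm, hN.smul]
    norm_triangle := fun x y =>
      (ENNReal.toReal_mono (ENNReal.add_ne_top.2 ⟨hN_top x, hN_top y⟩) (hN.add_le x y)).trans_eq
        (ENNReal.toReal_add (hN_top x) (hN_top y))
    norm_eq_zero_iff := fun x => by
      change (N x).toReal = 0 ↔ x = 0
      rw [ENNReal.toReal_eq_zero_iff, or_iff_left (hN_top x)]
      exact ⟨hN_zero x, fun h => by simpa [h] using hN.smul 0 0⟩ }

end Module

theorem isBanachSpaceFor_toReal {X : Type*} [AddCommGroup X] [Module ℂ X] {N : X → ℝ≥0∞}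
    (hN : IsExtendedSeminorm ℂ N) (hN_top : ∀ x, N x ≠ ∞) (hN_zero : ∀ x, N x = 0 → x = 0)
    (hcomplete : ∀ u : ℕ → X, (∀ ε > 0, ∃ n₀, ∀ m ≥ n₀, ∀ n ≥ n₀, N (u m - u n) < ε) →
      ∃ x, Tendsto (fun n => N (u n - x)) atTop (𝓝 0)) :
    IsBanachSpaceFor fun x => (N x).toReal := by
  let : Norm X := ⟨fun x => (N x).toReal⟩
  refine ⟨hN.normedSpaceCore hN_top hN_zero, ?_⟩
  let : NormedAddCommGroup X := NormedAddCommGroup.ofCore (hN.normedSpaceCore hN_top hN_zero)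
  change CompleteSpace X
  have hedist : ∀ x y : X, edist x y = N (x - y) := fun x y => by
    rw [edist_eq_enorm_sub, ← ofReal_norm]
    exact ENNReal.ofReal_toReal (hN_top _)
  refine EMetric.complete_of_cauchySeq_tendsto fun u hu => ?_
  obtain ⟨x, hx⟩ := hcomplete u (by simpa only [EMetric.cauchySeq_iff, hedist] using hu)
  exact ⟨x, tendsto_iff_edist_tendsto_0.2 (by simpa only [hedist] using hx)⟩

theorem isBanachSpaceFor_finiteSubmodule {X : Type*} [NormedAddCommGroup X] [NormedSpace ℂ X]
    [CompleteSpace X] {N : X → ℝ≥0∞} (hN : IsExtendedSeminorm ℂ N)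
    (hN_lsc : LowerSemicontinuous N) {K : Submodule ℂ X} (hK : IsClosed (K : Set X)) {c : ℝ≥0}
    (hc : c ≠ 0) (hNc : ∀ x, c * ‖x‖ₑ ≤ N x) :
    IsBanachSpaceFor fun x : hN.finiteSubmodule K => (N x).toReal := by
  have hc_coe : (c : ℝ≥0∞) ≠ 0 := ENNReal.coe_ne_zero.2 hc
  refine isBanachSpaceFor_toReal ⟨fun x y => hN.add_le x y, fun c x => hN.smul c x⟩
    (fun x => x.2.2.ne) (fun x hx => ?_) fun u hu_N => ?_
  · simpa [hx, hc] using hNc x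
  have hu_X : CauchySeq fun n => (u n : X) := by
    refine EMetric.cauchySeq_iff.2 fun ε hε => ?_
    obtain ⟨n₀, hn₀⟩ := hu_N (c * ε) (ENNReal.mul_pos hc_coe hε.ne')
    refine ⟨n₀, fun m hm n hn => ?_⟩
    rw [edist_eq_enorm_sub]
    exact lt_of_mul_lt_mul_left' ((hNc _).trans_lt (hn₀ m hm n hn))
  obtain ⟨x, hx⟩ := cauchySeq_tendsto_of_complete hu_X
  have hx_N : Tendsto (fun n => N (u n - x)) atTop (𝓝 0) :=
    tendsto_apply_sub_of_lowerSemicontinuous hN_lsc hx fun ε hε =>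
      (hu_N ε hε).imp fun _ h m hm n hn => (h m hm n hn).le
  have hx_mem : x ∈ hN.finiteSubmodule K := by
    obtain ⟨n, hn⟩ := (hx_N.eventually_lt_const one_pos).exists
    have hsub : (u n : X) - x ∈ hN.finiteSubmodule K :=
      ⟨K.sub_mem (u n).2.1 (hK.mem_of_tendsto hx (.of_forall fun k => (u k).2.1)),
        hn.trans ENNReal.one_lt_top⟩
    simpa using Submodule.sub_mem _ (u n).2 hsub
  exact ⟨⟨x, hx_mem⟩, hx_N⟩

end IsExtendedSeminorm

end Completeness

theorem isExtendedSeminorm_besselNorm {𝕜 E F ι : Type*} [RCLike 𝕜] [NormedAddCommGroup E]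
    [InnerProductSpace 𝕜 E] [NormedAddCommGroup F] [InnerProductSpace 𝕜 F] (d : ι → ℝ≥0) :
    IsExtendedSeminorm 𝕜 (besselNorm d : (E →L[𝕜] F) → ℝ≥0∞) where
  add_le := besselNorm_add_le d
  smul := besselNorm_smul d

end ChoquetTrace

end

open ChoquetTrace in
theorem mainTheorem3_general {H : Type*} [NormedAddCommGroup H] [InnerProductSpace ℂ H]
    [CompleteSpace H] (α : ℕ → NNReal) (hα0 : α 0 = 0) (hα : Monotone α) (hα1 : 0 < α 1)
    (hconc : ∀ i : ℕ, (α (i + 2) + α i) / 2 ≤ α (i + 1)) :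
    ∃ S : Submodule ℂ (H →L[ℂ] H),
      (S : Set (H →L[ℂ] H)) = weightedTraceClass α ∧
      IsBanachSpaceFor (fun a : S => (choquetENorm α (a : H →L[ℂ] H)).toReal) ∧
      (∀ a ∈ S, ∀ b : H →L[ℂ] H, a * b ∈ S ∧ b * a ∈ S) ∧
      (∀ a ∈ S, star a ∈ S) := by
  let S : Submodule ℂ (H →L[ℂ] H) := (isExtendedSeminorm_besselNorm
    (increments α)).finiteSubmodule (compactOperator (RingHom.id ℂ) H H)
  have hnorm {a : H →L[ℂ] H} (ha : IsCompactOperator a) :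
      choquetENorm α a = besselNorm (increments α) a :=
    choquetENorm_eq_besselNorm hα0 hα hconc ha
  have hincr : increments α 0 ≠ 0 := by simpa [increments, hα0] using hα1.ne'
  have hbanach : IsBanachSpaceFor
      fun a : S => (besselNorm (increments α) (a : H →L[ℂ] H)).toReal :=
    (isExtendedSeminorm_besselNorm _).isBanachSpaceFor_finiteSubmodule
      (lowerSemicontinuous_besselNorm _) isClosed_setOfPred_isCompactOperator hincr
      (mul_enorm_le_besselNorm _ 0)
  have hstar : ∀ a ∈ S, star a ∈ S := fun a ha =>
    ⟨isCompactOperator_adjoint ha.1, (besselNorm_adjoint_le _ a).trans_lt ha.2⟩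
  have hmul : ∀ a ∈ S, ∀ b, a * b ∈ S := fun a ha b =>
    ⟨ha.1.comp_clm b,
      (besselNorm_comp_le _ a b).trans_lt (ENNReal.mul_lt_top enorm_lt_top ha.2)⟩
  refine ⟨S, Set.ext fun a => and_congr_right fun ha => by rw [hnorm ha], ?_,
    fun a ha b => ⟨hmul a ha b, by simpa using hstar _ (hmul _ (hstar a ha) (star b))⟩, hstar⟩
  simpa only [fun a : S => hnorm a.2.1] using hbanach

theorem mainTheorem3 {H : Type*} [NormedAddCommGroup H] [InnerProductSpace ℂ H] [CompleteSpace H]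
    [TopologicalSpace.SeparableSpace H] (hH : ¬ FiniteDimensional ℂ H)
    (α : ℕ → NNReal) (hα0 : α 0 = 0) (hα : Monotone α) (hα1 : 0 < α 1)
    (hconc : ∀ i : ℕ, (α (i + 2) + α i) / 2 ≤ α (i + 1)) :
    ∃ S : Submodule ℂ (H →L[ℂ] H),
      (S : Set (H →L[ℂ] H)) = ChoquetTrace.weightedTraceClass α ∧
      ChoquetTrace.IsBanachSpaceFor
        (fun a : S => (ChoquetTrace.choquetENorm α (a : H →L[ℂ] H)).toReal) ∧
      (∀ a ∈ S, ∀ b : H →L[ℂ] H, a * b ∈ S ∧ b * a ∈ S) ∧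
      (∀ a ∈ S, star a ∈ S) :=
  mainTheorem3_general α hα0 hα hα1 hconc
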